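/- **Setting.** Let $\mathbb{F}$ be a finite field with $q$ elements and $p$ a prime with $p\equiv 3 \pmod 4$. Let $K$ be a subgroup of index $p$ of the multiplicative group $\mathbb{F}^*$ (so $p$ divides $q-1$ and $-1\in K$), and put $C=\mathbb{F}^*/K$, a group of order $p$ with identity $e$. Let $V=\mathbb{F}^2$ and $\Omega=\{Kv : v\in V\setminus\{0\}\}$, where $Kv=\{xv : x\in K\}$. The group $C$ acts on $\Omega$ by $(Kx)(Kv)=K(xv)$. Define $\langle\cdot,\cdot\rangle:\Omega\times\Omega\to C\cup\{0\}$ by $$\langle Ku,Kv\rangle=K\det(u,v),\qquad \det(u,v)=u_1v_2-u_2v_1,$$ the value being $0$ when $\det(u,v)=0$. For $g\in C$ put $$r_g=\{(\alpha,\beta)\in\Omega^2 : \langle\alpha,\beta\rangle=0,\ \beta=g\alpha\},\qquad s_g=\{(\alpha,\beta)\in\Omega^2 : \langle\alpha,\beta\rangle=g\},$$ and put $r_X=\bigcup_{g\in X}r_g$ for $X\subseteq C$. The Tatra scheme is the association scheme $\mathcal{X}_0=(\Omega,S_0)$ with the set of basic relations $S_0=\{r_g,s_g : g\in C\}$. Let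 $M$ be a subgroup of index $2$ of $\mathrm{Aut}(C)$, and let $C_1,C_2$ be the two orbits of $M$ on $C$ that are distinct from $\{e\}$. For a permutation $f$ of $\Omega$ and $s\subseteq\Omega^2$ write $s^f=\{(\alpha^f,\beta^f) : (\alpha,\beta)\in s\}$. **Proposition 4.4.** Let $f\in\mathrm{Sym}(\Omega)$ be such that $s_g^f=s_g$ for some $g\in C$ and $\{r_{C_1}^f,r_{C_2}^f\}=\{r_{C_1},r_{C_2}\}$. Then $f$ belongs to the group $\mathrm{Iso}(\mathcal{X}_0)$ of isomorphisms of $\mathcal{X}_0$ onto itself, i.e. $\{s^f : s\in S_0\}=S_0$. -/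

import Mathlib

/-- The image `s^f = {(f α, f β) : (α, β) ∈ s}` of a binary relation `s` under a map `f`. -/
def relImage {Ω Ω' : Type*} (f : Ω → Ω') (s : Set (Ω × Ω)) : Set (Ω' × Ω') :=
  Prod.map f f '' s

/-- An association scheme on a finite set `Ω`, given by its set of basic relations. -/
structure AssocScheme (Ω : Type*) [Finite Ω] where
  /-- the set of basic relations -/
  rels : Set (Set (Ω × Ω))
  isPartition : Setoid.IsPartition rels
  diagonal_mem : Set.diagonal Ω ∈ rels
  swap_mem : ∀ s ∈ rels, Prod.swap ⁻¹' s ∈ rels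
  /-- the intersection numbers do not depend on the choice of the pair in `t` -/
  intersection : ∀ r ∈ rels, ∀ s ∈ rels, ∀ t ∈ rels, ∀ a ∈ t, ∀ b ∈ t,
    {γ | (a.1, γ) ∈ r ∧ (γ, a.2) ∈ s}.ncard = {γ | (b.1, γ) ∈ r ∧ (γ, b.2) ∈ s}.ncard

/-- An isomorphism from one scheme to another: a bijection of the point sets that maps the set
of basic relations onto the set of basic relations. -/
def AssocScheme.IsIso {Ω Ω' : Type*} [Finite Ω] [Finite Ω'] (X : AssocScheme Ω)
    (X' : AssocScheme Ω') (f : Ω ≃ Ω') : Prop :=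
  relImage f '' X.rels = X'.rels

/-- The group of all isomorphisms of a scheme onto itself. -/
def AssocScheme.iso {Ω : Type*} [Finite Ω] (X : AssocScheme Ω) : Subgroup (Equiv.Perm Ω) where
  carrier := {f | X.IsIso X f}
  one_mem' := by
    have h : relImage (⇑(1 : Equiv.Perm Ω)) = id := by
      funext s
      simp [relImage]
    simp only [Set.mem_ofPred_eq, AssocScheme.IsIso, h, Set.image_id]
  mul_mem' := by
    intro a b ha hb
    have h : relImage (⇑(a * b)) = relImage a ∘ relImage b := by
      funext s
      simp only [relImage, Function.comp_apply, Set.image_image, Equiv.Perm.coe_mul]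
      rfl
    simp only [Set.mem_ofPred_eq, AssocScheme.IsIso] at *
    rw [h, Set.image_comp, hb, ha]
  inv_mem' := by
    intro a ha
    have h : relImage (⇑a⁻¹) ∘ relImage a = id := by
      funext s
      have h2 : Prod.map ⇑a⁻¹ ⇑a⁻¹ ∘ Prod.map ⇑a ⇑a = id := by
        funext x
        exact Prod.ext (a.symm_apply_apply x.1) (a.symm_apply_apply x.2)
      simp only [relImage, Function.comp_apply, id_eq]
      rw [← Set.image_comp, h2, Set.image_id]
    simp only [Set.mem_ofPred_eq, AssocScheme.IsIso] at *
    conv_lhs => rw [← ha]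
    rw [← Set.image_comp, h, Set.image_id]

namespace Tatra

/-- `det (u, v) = u₁ v₂ - u₂ v₁`. -/
def det2 {F : Type*} [Field F] (u v : Fin 2 → F) : F := u 0 * v 1 - u 1 * v 0

/-- The equivalence relation on nonzero vectors whose classes are the sets `K v`. -/
def pointSetoid {F : Type*} [Field F] (K : Subgroup Fˣ) : Setoid {v : Fin 2 → F // v ≠ 0} :=
  (MulAction.orbitRel K (Fin 2 → F)).comap Subtype.val

/-- The set `Ω` of all classes `K v` of nonzero vectors `v`. -/
def Point {F : Type*} [Field F] (K : Subgroup Fˣ) : Type _ := Quotient (pointSetoid K)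

/-- The point `K v`. -/
def Point.mk {F : Type*} [Field F] (K : Subgroup Fˣ) (v : Fin 2 → F) (hv : v ≠ 0) : Point K :=
  Quotient.mk (pointSetoid K) ⟨v, hv⟩

instance {F : Type*} [Field F] [Finite F] (K : Subgroup Fˣ) : Finite (Point K) :=
  inferInstanceAs (Finite (Quotient (pointSetoid K)))

theorem pointSetoid_iff {F : Type*} [Field F] {K : Subgroup Fˣ}
    {u v : {v : Fin 2 → F // v ≠ 0}} :
    pointSetoid K u v ↔ ∃ k : Fˣ, k ∈ K ∧ k • v.1 = u.1 := by
  constructor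
  · rintro ⟨k, hk⟩
    exact ⟨k.1, k.2, hk⟩
  · rintro ⟨k, hk, h⟩
    exact ⟨⟨k, hk⟩, h⟩

theorem units_smul_ne_zero {F : Type*} [Field F] (x : Fˣ) {v : Fin 2 → F} (hv : v ≠ 0) :
    x • v ≠ 0 := fun h => hv ((smul_eq_zero_iff_eq x).mp h)

/-- The action of `C = Fˣ ⧸ K` on `Ω`: `(K x) (K v) = K (x v)`. -/
instance {F : Type*} [Field F] (K : Subgroup Fˣ) : SMul (Fˣ ⧸ K) (Point K) where
  smul g α := Quotient.liftOn₂' g α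
    (fun x v => Point.mk K (x • v.1) (units_smul_ne_zero x v.2)) (by
      intro x v y w hxy hvw
      have hxy' : x⁻¹ * y ∈ K := QuotientGroup.leftRel_apply.mp hxy
      obtain ⟨k, hk, h⟩ := pointSetoid_iff.mp hvw
      refine Quotient.sound (pointSetoid_iff.mpr ⟨(x⁻¹ * y)⁻¹ * k, ?_, ?_⟩)
      · exact K.mul_mem (K.inv_mem hxy') hk
      · simp only [← h, smul_smul]
        congr 1
        rw [mul_inv_rev, inv_inv, mul_assoc, mul_comm k y, mul_comm y⁻¹, mul_assoc,
          inv_mul_cancel_left, mul_comm])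

open Classical in
/-- The class `K x` of an element `x` of the field, as an element of `C ∪ {0}`. -/
noncomputable def cls {F : Type*} [Field F] (K : Subgroup Fˣ) (x : F) : WithZero (Fˣ ⧸ K) :=
  if h : x = 0 then 0 else ((QuotientGroup.mk (Units.mk0 x h) : Fˣ ⧸ K) : WithZero (Fˣ ⧸ K))

theorem cls_mul_left {F : Type*} [Field F] {K : Subgroup Fˣ} {k : Fˣ} (hk : k ∈ K) (x : F) :
    cls K ((k : F) * x) = cls K x := by
  unfold cls
  by_cases hx : x = 0
  · simp [hx]
  · have : (k : F) * x ≠ 0 := mul_ne_zero k.ne_zero hx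
    rw [dif_neg this, dif_neg hx]
    congr 1
    rw [QuotientGroup.eq]
    have : (Units.mk0 ((k : F) * x) this)⁻¹ * Units.mk0 x hx = k⁻¹ := by
      ext
      simp
    rw [this]
    exact K.inv_mem hk

theorem det2_smul {F : Type*} [Field F] (a b : Fˣ) (u v : Fin 2 → F) :
    det2 (a • u) (b • v) = ((a * b : Fˣ) : F) * det2 u v := by
  simp [det2, Units.smul_def]
  ring

/-- The form `⟨K u, K v⟩ = K det (u, v)` with values in `C ∪ {0}`. -/
noncomputable def form {F : Type*} [Field F] (K : Subgroup Fˣ) (α β : Point K) :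
    WithZero (Fˣ ⧸ K) :=
  Quotient.liftOn₂' α β (fun u v => cls K (det2 u.1 v.1)) (by
    intro u v u' v' hu hv
    obtain ⟨a, ha, h1⟩ := pointSetoid_iff.mp hu
    obtain ⟨b, hb, h2⟩ := pointSetoid_iff.mp hv
    simp only [← h1, ← h2, det2_smul, cls_mul_left (K.mul_mem ha hb)])

/-- The relation `r_g`. -/
def relR {F : Type*} [Field F] (K : Subgroup Fˣ) (g : Fˣ ⧸ K) : Set (Point K × Point K) :=
  {a | form K a.1 a.2 = 0 ∧ a.2 = g • a.1}

/-- The relation `s_g`. -/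
def relS {F : Type*} [Field F] (K : Subgroup Fˣ) (g : Fˣ ⧸ K) : Set (Point K × Point K) :=
  {a | form K a.1 a.2 = (g : WithZero (Fˣ ⧸ K))}

/-- The relation `r_X`, the union of all `r_g` with `g ∈ X`. -/
def relRSet {F : Type*} [Field F] (K : Subgroup Fˣ) (X : Set (Fˣ ⧸ K)) :
    Set (Point K × Point K) :=
  ⋃ g ∈ X, relR K g

/-- The set of basic relations `S₀ = {r_g, s_g : g ∈ C}`. -/
def basicRels {F : Type*} [Field F] (K : Subgroup Fˣ) : Set (Set (Point K × Point K)) :=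
  Set.range (relR K) ∪ Set.range (relS K)

/-- The basic sets of the cyclotomic S-ring `cyc (M, G)`: the orbits on `G` of a group `M` of
automorphisms of `G`. -/
def cycBasicSets {G : Type*} [Group G] (M : Subgroup (MulAut G)) : Set (Set G) :=
  Set.range fun g : G => MulAction.orbit M g

/-! Facts needed to see that `(Ω, S₀)` is a scheme as soon as `-1 ∈ K`. -/

section

variable {F : Type*} [Field F] {K : Subgroup Fˣ}

theorem Point.ind {P : Point K → Prop} (h : ∀ v hv, P (Point.mk K v hv)) (α : Point K) : P α :=
  Quotient.ind (fun v => h v.1 v.2) α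

theorem mk_eq_mk {u v : Fin 2 → F} {hu : u ≠ 0} {hv : v ≠ 0} :
    Point.mk K u hu = Point.mk K v hv ↔ ∃ k : Fˣ, k ∈ K ∧ k • v = u :=
  (Quotient.eq (r := pointSetoid K)).trans pointSetoid_iff

theorem smul_mk (x : Fˣ) (v : Fin 2 → F) (hv : v ≠ 0) :
    (QuotientGroup.mk x : Fˣ ⧸ K) • Point.mk K v hv
      = Point.mk K (x • v) (units_smul_ne_zero x hv) := rfl

theorem form_mk (u v : Fin 2 → F) (hu : u ≠ 0) (hv : v ≠ 0) :
    form K (Point.mk K u hu) (Point.mk K v hv) = cls K (det2 u v) := rfl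

theorem cls_eq_zero {x : F} : cls K x = 0 ↔ x = 0 := by
  unfold cls
  split_ifs with h <;> simp [h]

theorem cls_unit (x : Fˣ) :
    cls K (x : F) = ((QuotientGroup.mk x : Fˣ ⧸ K) : WithZero (Fˣ ⧸ K)) := by
  unfold cls
  rw [dif_neg x.ne_zero]
  simp

theorem exists_det2_ne_zero {u : Fin 2 → F} (hu : u ≠ 0) : ∃ w, det2 u w = 1 := by
  by_cases h0 : u 0 = 0
  · have h1 : u 1 ≠ 0 := by
      intro h1
      apply hu
      funext i
      fin_cases i <;> simp [h0, h1]
    exact ⟨![-(u 1)⁻¹, 0], by simp [det2, h1]⟩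
  · exact ⟨![0, (u 0)⁻¹], by simp [det2, h0]⟩

theorem ne_zero_of_det2_left {u w : Fin 2 → F} (h : det2 u w ≠ 0) : u ≠ 0 := by
  rintro rfl
  simp [det2] at h

theorem ne_zero_of_det2_right {u w : Fin 2 → F} (h : det2 u w ≠ 0) : w ≠ 0 := by
  rintro rfl
  simp [det2] at h

theorem exists_smul_of_det2_eq_zero {u v : Fin 2 → F} (hu : u ≠ 0) (hv : v ≠ 0)
    (h : det2 u v = 0) : ∃ x : Fˣ, v = x • u := by
  obtain ⟨w, hw⟩ := exists_det2_ne_zero hu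
  have key : v = det2 v w • u := by
    simp only [det2] at h hw ⊢
    funext i
    fin_cases i
    · simp only [Fin.zero_eta, Pi.smul_apply, smul_eq_mul]
      linear_combination (-v 0) * hw + (w 0) * h
    · simp only [Fin.mk_one, Pi.smul_apply, smul_eq_mul]
      linear_combination (-v 1) * hw + (w 1) * h
  have hne : det2 v w ≠ 0 := by
    intro h0
    rw [h0, zero_smul] at key
    exact hv key
  exact ⟨Units.mk0 _ hne, by rw [Units.smul_def]; exact key⟩

theorem unit_smul_left_cancel {x y : Fˣ} {v : Fin 2 → F} (hv : v ≠ 0) (h : x • v = y • v) :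
    x = y := by
  rw [Units.smul_def, Units.smul_def] at h
  exact Units.ext (smul_left_injective F hv h)

theorem form_smul_self (g : Fˣ ⧸ K) (α : Point K) : form K α (g • α) = 0 := by
  induction α using Point.ind with
  | h v hv =>
    induction g using QuotientGroup.induction_on with
    | H x =>
      rw [smul_mk, form_mk, cls_eq_zero]
      simp [det2, Units.smul_def]
      ring

theorem mem_relR {g : Fˣ ⧸ K} {a : Point K × Point K} : a ∈ relR K g ↔ a.2 = g • a.1 := by
  refine ⟨fun h => h.2, fun h => ⟨?_, h⟩⟩
  rw [h]
  exact form_smul_self g a.1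

theorem smul_point_cancel {g h : Fˣ ⧸ K} {α : Point K} (e : g • α = h • α) : g = h := by
  induction α using Point.ind with
  | h v hv =>
    induction g using QuotientGroup.induction_on with
    | H x =>
      induction h using QuotientGroup.induction_on with
      | H y =>
        rw [smul_mk, smul_mk, mk_eq_mk] at e
        obtain ⟨k, hk, e⟩ := e
        rw [smul_smul] at e
        have := unit_smul_left_cancel hv e
        rw [QuotientGroup.eq]
        rw [← this]
        simpa using hk

theorem exists_smul_of_form_eq_zero {α β : Point K} (h : form K α β = 0) :
    ∃ g : Fˣ ⧸ K, β = g • α := by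
  induction α using Point.ind with
  | h u hu =>
    induction β using Point.ind with
    | h v hv =>
      rw [form_mk, cls_eq_zero] at h
      obtain ⟨x, rfl⟩ := exists_smul_of_det2_eq_zero hu hv h
      exact ⟨QuotientGroup.mk x, rfl⟩

theorem exists_point : ∃ v : Fin 2 → F, v ≠ 0 :=
  ⟨![1, 0], fun h => by simpa using congrFun h 0⟩

theorem basicRels_isPartition (K : Subgroup Fˣ) : Setoid.IsPartition (basicRels K) := by
  constructor
  · rintro (⟨g, hg⟩ | ⟨g, hg⟩)
    · obtain ⟨v, hv⟩ := exists_point (F := F)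
      have : (Point.mk K v hv, g • Point.mk K v hv) ∈ relR K g := mem_relR.mpr rfl
      rw [hg] at this
      exact this
    · obtain ⟨v, hv⟩ := exists_point (F := F)
      obtain ⟨w, hw⟩ := exists_det2_ne_zero hv
      induction g using QuotientGroup.induction_on with
      | H x =>
        have hw0 : w ≠ 0 := ne_zero_of_det2_right (by rw [hw]; exact one_ne_zero)
        have : (Point.mk K v hv, Point.mk K (x • w) (units_smul_ne_zero x hw0))
            ∈ relS K (QuotientGroup.mk x) := by
          change cls K (det2 v (x • w)) = _
          rw [← cls_unit, ← one_smul Fˣ v, det2_smul, hw]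
          simp
        rw [hg] at this
        exact this
  · rintro ⟨α, β⟩
    by_cases h : form K α β = 0
    · obtain ⟨g, rfl⟩ := exists_smul_of_form_eq_zero h
      refine ⟨relR K g, ⟨Or.inl ⟨g, rfl⟩, mem_relR.mpr rfl⟩, ?_⟩
      rintro t ⟨⟨g', rfl⟩ | ⟨g', rfl⟩, ht⟩
      · rw [smul_point_cancel (mem_relR.mp ht)]
      · have ht' : form K α (g • α) = _ := ht
        rw [h] at ht'
        exact absurd ht'.symm WithZero.coe_ne_zero
    · obtain ⟨g, hg⟩ := WithZero.ne_zero_iff_exists.mp h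
      refine ⟨relS K g, ⟨Or.inr ⟨g, rfl⟩, hg.symm⟩, ?_⟩
      rintro t ⟨⟨g', rfl⟩ | ⟨g', rfl⟩, ht⟩
      · exact absurd ht.1 h
      · have ht' : form K α β = _ := ht
        rw [← hg, WithZero.coe_inj] at ht'
        rw [ht']

theorem form_symm (hK : (-1 : Fˣ) ∈ K) (α β : Point K) : form K α β = form K β α := by
  induction α using Point.ind with
  | h u hu =>
    induction β using Point.ind with
    | h v hv =>
      rw [form_mk, form_mk, ← cls_mul_left hK]
      congr 1
      simp [det2]
      ring

/-- A linear map carrying `u, w` to `u', w'`, and its effect on `det`. -/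
theorem exists_move {u w u' w' : Fin 2 → F} (hd : det2 u w ≠ 0) (k : Fˣ)
    (hd' : det2 u' w' = k * det2 u w) :
    ∃ T : (Fin 2 → F) → (Fin 2 → F), T u = u' ∧ T w = w' ∧ (∀ (x : Fˣ) v, T (x • v) = x • T v) ∧
      (∀ v, v ≠ 0 → T v ≠ 0) ∧ (∀ a b, T a = T b → a = b) ∧
      ∀ a b, det2 (T a) (T b) = k * det2 a b := by
  let T : (Fin 2 → F) → (Fin 2 → F) := fun x =>
    (det2 x w / det2 u w) • u' + (det2 u x / det2 u w) • w'
  have hgen : ∀ A B A' B' D : F, det2 ((A / D) • u' + (B / D) • w') ((A' / D) • u' + (B' / D) • w')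
      = (A * B' - B * A') / D ^ 2 * det2 u' w' := by
    intro A B A' B' D
    simp only [det2, Pi.add_apply, Pi.smul_apply, smul_eq_mul]
    ring
  have hdet : ∀ a b, det2 (T a) (T b) = k * det2 a b := by
    intro a b
    have h1 : det2 (T a) (T b) =
        (det2 a w * det2 u b - det2 u a * det2 b w) / (det2 u w) ^ 2 * det2 u' w' := hgen _ _ _ _ _
    have h2 : det2 a w * det2 u b - det2 u a * det2 b w = det2 u w * det2 a b := by
      simp only [det2]
      ring
    rw [h1, h2, hd']
    field_simp
  have hsub : ∀ a b, T (a - b) = T a - T b := by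
    intro a b
    funext i
    simp only [T, det2, Pi.add_apply, Pi.smul_apply, smul_eq_mul, Pi.sub_apply]
    ring
  have hne : ∀ v, v ≠ 0 → T v ≠ 0 := by
    intro v hv h0
    obtain ⟨y, hy⟩ := exists_det2_ne_zero hv
    have := hdet v y
    rw [h0, hy, mul_one] at this
    exact k.ne_zero (by rw [← this]; simp [det2])
  refine ⟨T, ?_, ?_, ?_, hne, ?_, hdet⟩
  · have : det2 u u = 0 := by simp only [det2]; ring
    simp [T, this, hd]
  · have : det2 w w = 0 := by simp only [det2]; ring
    simp [T, this, hd]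
  · intro x v
    funext i
    simp only [T, det2, Pi.add_apply, Pi.smul_apply, smul_eq_mul, Units.smul_def]
    ring
  · intro a b hab
    by_contra hne'
    exact hne (a - b) (sub_ne_zero.mpr hne') (by rw [hsub, hab, sub_self])

theorem exists_move_point {u w u' w' : Fin 2 → F} (hd : det2 u w ≠ 0) (k : Fˣ) (hk : k ∈ K)
    (hd' : det2 u' w' = k * det2 u w) (hu : u ≠ 0) (hw : w ≠ 0) (hu' : u' ≠ 0) (hw' : w' ≠ 0) :
    ∃ φ : Point K → Point K, Function.Injective φ ∧
      (∀ t ∈ basicRels K, ∀ a ∈ t, (φ a.1, φ a.2) ∈ t) ∧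
      φ (Point.mk K u hu) = Point.mk K u' hu' ∧ φ (Point.mk K w hw) = Point.mk K w' hw' ∧
      ∀ (g : Fˣ ⧸ K) α, φ (g • α) = g • φ α := by
  obtain ⟨T, h1, h2, hs, hne, hinj, hdet⟩ := exists_move hd k hd'
  let φ : Point K → Point K := fun α => Quotient.liftOn' α
    (fun v => Point.mk K (T v.1) (hne v.1 v.2)) (by
      intro a b hab
      obtain ⟨l, hl, h⟩ := pointSetoid_iff.mp hab
      exact mk_eq_mk.mpr ⟨l, hl, by rw [← hs, h]⟩)
  have hφ : ∀ v hv, φ (Point.mk K v hv) = Point.mk K (T v) (hne v hv) := fun _ _ => rfl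
  have hsm : ∀ (g : Fˣ ⧸ K) α, φ (g • α) = g • φ α := by
    intro g α
    induction α using Point.ind with
    | h v hv =>
      induction g using QuotientGroup.induction_on with
      | H x =>
        rw [smul_mk, hφ, hφ, smul_mk]
        congr 1
        exact hs x v
  have hform : ∀ α β, form K (φ α) (φ β) = form K α β := by
    intro α β
    induction α using Point.ind with
    | h v hv =>
      induction β using Point.ind with
      | h v' hv' => rw [hφ, hφ, form_mk, form_mk, hdet, cls_mul_left hk]
  refine ⟨φ, ?_, ?_, ?_, ?_, hsm⟩
  · intro α β hab
    induction α using Point.ind with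
    | h v hv =>
      induction β using Point.ind with
      | h v' hv' =>
        rw [hφ, hφ, mk_eq_mk] at hab
        obtain ⟨l, hl, h⟩ := hab
        rw [← hs] at h
        exact mk_eq_mk.mpr ⟨l, hl, hinj _ _ h⟩
  · rintro t (⟨g, rfl⟩ | ⟨g, rfl⟩) a ha
    · rw [mem_relR] at ha ⊢
      change φ a.2 = g • φ a.1
      rw [ha, hsm]
    · change form K (φ a.1) (φ a.2) = _
      rw [hform]
      exact ha
  · rw [hφ]
    congr 1
  · rw [hφ]
    congr 1

/-- An injective map of `Ω` that carries one pair of a basic relation to another one and preserves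
every basic relation. -/
theorem exists_move_rel {t : Set (Point K × Point K)} (ht : t ∈ basicRels K)
    {a b : Point K × Point K} (ha : a ∈ t) (hb : b ∈ t) :
    ∃ φ : Point K → Point K, Function.Injective φ ∧
      (∀ t ∈ basicRels K, ∀ a ∈ t, (φ a.1, φ a.2) ∈ t) ∧ φ a.1 = b.1 ∧ φ a.2 = b.2 := by
  obtain ⟨α, β⟩ := a
  obtain ⟨α', β'⟩ := b
  rcases ht with ⟨g, rfl⟩ | ⟨g, rfl⟩
  · rw [mem_relR] at ha hb
    simp only at ha hb
    subst ha hb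
    induction α using Point.ind with
    | h u hu =>
      induction α' using Point.ind with
      | h u' hu' =>
        obtain ⟨w, hw⟩ := exists_det2_ne_zero hu
        obtain ⟨w', hw'⟩ := exists_det2_ne_zero hu'
        have hn : det2 u w ≠ 0 := by rw [hw]; exact one_ne_zero
        have hn' : det2 u' w' ≠ 0 := by rw [hw']; exact one_ne_zero
        obtain ⟨φ, hi, hp, h1, -, hs⟩ := exists_move_point hn 1 K.one_mem (by simp [hw, hw'])
          hu (ne_zero_of_det2_right hn) hu' (ne_zero_of_det2_right hn')
        exact ⟨φ, hi, hp, h1, by simp only [hs, h1]⟩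
  · induction α using Point.ind with
    | h u hu =>
      induction α' using Point.ind with
      | h u' hu' =>
        induction β using Point.ind with
        | h w hw =>
          induction β' using Point.ind with
          | h w' hw' =>
            have ha' : cls K (det2 u w) = g := ha
            have hb' : cls K (det2 u' w') = g := hb
            have hn : det2 u w ≠ 0 := fun h0 => by
              rw [cls_eq_zero.mpr h0] at ha'
              exact WithZero.coe_ne_zero ha'.symm
            have hn' : det2 u' w' ≠ 0 := fun h0 => by
              rw [cls_eq_zero.mpr h0] at hb'
              exact WithZero.coe_ne_zero hb'.symm
            have he : (QuotientGroup.mk (Units.mk0 _ hn) : Fˣ ⧸ K)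
                = QuotientGroup.mk (Units.mk0 _ hn') := by
              rw [← WithZero.coe_inj, ← cls_unit, ← cls_unit]
              exact ha'.trans hb'.symm
            rw [QuotientGroup.eq] at he
            obtain ⟨φ, hi, hp, h1, h2, -⟩ := exists_move_point hn _ he
              (by simp; field_simp) hu hw hu' hw'
            exact ⟨φ, hi, hp, h1, h2⟩

theorem intersection_le [Finite F] {r s t : Set (Point K × Point K)} (hr : r ∈ basicRels K)
    (hs : s ∈ basicRels K) (ht : t ∈ basicRels K) {a b : Point K × Point K}
    (ha : a ∈ t) (hb : b ∈ t) :
    {γ | (a.1, γ) ∈ r ∧ (γ, a.2) ∈ s}.ncard ≤ {γ | (b.1, γ) ∈ r ∧ (γ, b.2) ∈ s}.ncard := by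
  obtain ⟨φ, hi, hp, h1, h2⟩ := exists_move_rel ht ha hb
  refine Set.ncard_le_ncard_of_injOn φ ?_ hi.injOn (Set.toFinite _)
  rintro γ ⟨h3, h4⟩
  refine ⟨?_, ?_⟩
  · rw [← h1]
    exact hp r hr _ h3
  · rw [← h2]
    exact hp s hs _ h4

end

/-- The Tatra scheme `X₀ = (Ω, S₀)`. -/
def scheme {F : Type*} [Field F] [Finite F] (K : Subgroup Fˣ) (hK : (-1 : Fˣ) ∈ K) :
    AssocScheme (Point K) where
  rels := basicRels K
  isPartition := basicRels_isPartition K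
  diagonal_mem := by
    refine Or.inl ⟨1, ?_⟩
    ext ⟨α, β⟩
    have h1 : (1 : Fˣ ⧸ K) • α = α := by
      induction α using Point.ind with
      | h v hv =>
        change (QuotientGroup.mk 1 : Fˣ ⧸ K) • _ = _
        rw [smul_mk, mk_eq_mk]
        exact ⟨1, K.one_mem, rfl⟩
    rw [mem_relR, Set.mem_diagonal_iff, h1]
    exact eq_comm
  swap_mem := by
    rintro s (⟨g, rfl⟩ | ⟨g, rfl⟩)
    · refine Or.inl ⟨g⁻¹, ?_⟩
      have h1 : ∀ (g : Fˣ ⧸ K) (α β : Point K), β = g • α → α = g⁻¹ • β := by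
        rintro g α β rfl
        induction α using Point.ind with
        | h v hv =>
          induction g using QuotientGroup.induction_on with
          | H x =>
            rw [← QuotientGroup.mk_inv, smul_mk, smul_mk, mk_eq_mk]
            exact ⟨1, K.one_mem, by simp⟩
      ext ⟨α, β⟩
      rw [mem_relR, Set.mem_preimage, mem_relR]
      refine ⟨fun h => ?_, fun h => h1 g β α h⟩
      have := h1 g⁻¹ α β h
      rwa [inv_inv] at this
    · refine Or.inr ⟨g, ?_⟩
      ext ⟨α, β⟩
      change form K α β = _ ↔ form K β α = _
      rw [form_symm hK]
  intersection := fun _ hr _ hs _ ht _ ha _ hb =>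
    le_antisymm (intersection_le hr hs ht ha hb) (intersection_le hr hs ht hb ha)

/-- A subgroup of odd index contains `-1`. -/
theorem neg_one_mem_of_odd_index {F : Type*} [Field F] {K : Subgroup Fˣ} (h : Odd K.index) :
    (-1 : Fˣ) ∈ K := by
  obtain ⟨c, hc⟩ := h
  have := K.pow_index_mem (-1 : Fˣ)
  rwa [hc, pow_succ, pow_mul, neg_one_sq, one_pow, one_mul] at this

/-- A prime congruent to `3` modulo `4` is odd, so a subgroup of such an index contains `-1`. -/
theorem neg_one_mem {F : Type*} [Field F] {K : Subgroup Fˣ} {p : ℕ} (hp4 : p % 4 = 3)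
    (hK : K.index = p) : (-1 : Fˣ) ∈ K :=
  neg_one_mem_of_odd_index (by rw [hK, Nat.odd_iff]; omega)

end Tatra

namespace Tatra

section

variable {F : Type*} [Field F] {K : Subgroup Fˣ}

/-! Each pair of distinct points in a common `C`-orbit lies in `r_{C₁}` or `r_{C₂}`, so `f` carries
`C`-orbits into `C`-orbits and `f (h • α) = ψ h α • f α` for some `ψ h α` in `C`. The crux is that
`ψ h α` does not depend on `α`. If `⟨α, β⟩ = g`, then also `⟨h • α, h⁻¹ • β⟩ = g`; applying `f` and
cancelling gives `ψ h α * ψ h⁻¹ β = 1`. Hence two points with a common `s_g`-neighbour share the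
value of `ψ h`. Points in different orbits always have such a neighbour (`exists_common_neighbour`),
and points in one orbit are compared through a point outside it (`exists_semilinear`). Thus `f (h •
α) = φ h • f α`. Freeness of the action makes `φ` an injective endomorphism of the finite group `C`,
so `f` permutes the `r_a`. Since `⟨α, β⟩ = a * g` means `⟨α, a⁻¹ • β⟩ = g`, it also sends `s_{ag}`
to `s_{φ(a)g}` (`mem_iso_scheme`). -/

/-! ### The action of `C` and the form. -/

theorem mul_smul_point (a b : Fˣ ⧸ K) (α : Point K) : (a * b) • α = a • b • α := by
  induction α using Point.ind with
  | h v hv =>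
    induction a using QuotientGroup.induction_on with
    | H x =>
      induction b using QuotientGroup.induction_on with
      | H y =>
        rw [← QuotientGroup.mk_mul, smul_mk, smul_mk, smul_mk, mk_eq_mk]
        exact ⟨1, K.one_mem, by simp [mul_smul]⟩

theorem one_smul_point (α : Point K) : (1 : Fˣ ⧸ K) • α = α := by
  induction α using Point.ind with
  | h v hv =>
    rw [← QuotientGroup.mk_one, smul_mk, mk_eq_mk]
    exact ⟨1, K.one_mem, rfl⟩

theorem cls_unit_mul (x : Fˣ) (y : F) :
    cls K ((x : F) * y) = ((QuotientGroup.mk x : Fˣ ⧸ K) : WithZero (Fˣ ⧸ K)) * cls K y := by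
  by_cases hy : y = 0
  · rw [hy, mul_zero, cls_eq_zero.mpr rfl]
    exact (mul_zero (M₀ := WithZero (Fˣ ⧸ K)) _).symm
  · lift y to Fˣ using isUnit_iff_ne_zero.mpr hy
    rw [← Units.val_mul, cls_unit, cls_unit, QuotientGroup.mk_mul, WithZero.coe_mul]

/-- The form is bilinear with respect to the action of `C`. -/
theorem form_smul_smul (a b : Fˣ ⧸ K) (α β : Point K) :
    form K (a • α) (b • β) = ((a * b : Fˣ ⧸ K) : WithZero (Fˣ ⧸ K)) * form K α β := by
  induction α using Point.ind with
  | h u hu =>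
    induction β using Point.ind with
    | h v hv =>
      induction a using QuotientGroup.induction_on with
      | H x =>
        induction b using QuotientGroup.induction_on with
        | H y =>
          rw [smul_mk, smul_mk, form_mk, form_mk, det2_smul, cls_unit_mul, QuotientGroup.mk_mul]

/-- Reduces every relation `s_{ab}` to `s_b` by moving the second point within its orbit; this is
how invariance of the single relation `s_g` controls all the others. -/
theorem form_smul_right_eq_iff (a b : Fˣ ⧸ K) (α β : Point K) :
    form K α (a⁻¹ • β) = b ↔ form K α β = ((a * b : Fˣ ⧸ K) : WithZero (Fˣ ⧸ K)) := by
  have h : form K α (a⁻¹ • β) = ((a⁻¹ : Fˣ ⧸ K) : WithZero (Fˣ ⧸ K)) * form K α β := by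
    conv_lhs => rw [← one_smul_point α]
    rw [form_smul_smul]
    exact congrArg (fun c : Fˣ ⧸ K => (c : WithZero (Fˣ ⧸ K)) * form K α β) (one_mul a⁻¹)
  rw [h, WithZero.coe_inv, WithZero.coe_mul]
  exact inv_mul_eq_iff_eq_mul₀ (G₀ := WithZero (Fˣ ⧸ K)) WithZero.coe_ne_zero

/-! ### Rigidity: one permutation of `C` serves all points. -/

/-- Two points in different `C`-orbits have a common neighbour with respect to `s_g`. -/
theorem exists_common_neighbour {α γ : Point K} (h : form K α γ ≠ 0) (g : Fˣ ⧸ K) :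
    ∃ β, form K α β = g ∧ form K γ β = g := by
  induction α using Point.ind with
  | h u hu =>
    induction γ using Point.ind with
    | h v hv =>
      induction g using QuotientGroup.induction_on with
      | H x =>
        rw [form_mk, Ne, cls_eq_zero] at h
        -- A vector `w` with `det (u, w) = det (v, w)` satisfies `det (v - u, w) = 0`, so it is a
        -- multiple of `v - u`; the factor is fixed by requiring the common value `x`.
        have key : ∀ y : Fin 2 → F, det2 y (((x : F) / det2 u v) • (v - u))
            = (x : F) / det2 u v * (det2 y v - det2 y u) := by
          intro y
          simp only [det2, Pi.smul_apply, Pi.sub_apply, smul_eq_mul]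
          ring
        have hself : ∀ y : Fin 2 → F, det2 y y = 0 := fun y => by simp only [det2]; ring
        have h1 : det2 u (((x : F) / det2 u v) • (v - u)) = x := by
          rw [key, hself]
          field_simp
          ring
        have h2 : det2 v (((x : F) / det2 u v) • (v - u)) = x := by
          have hvu : det2 v u = -det2 u v := by simp only [det2]; ring
          rw [key, hself, hvu]
          field_simp
          ring
        have hne : ((x : F) / det2 u v) • (v - u) ≠ 0 :=
          ne_zero_of_det2_right (h1 ▸ x.ne_zero)
        exact ⟨Point.mk K _ hne, by rw [form_mk, h1, cls_unit], by rw [form_mk, h2, cls_unit]⟩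

theorem exists_form_ne_zero (α : Point K) : ∃ γ, form K α γ ≠ 0 := by
  induction α using Point.ind with
  | h u hu =>
    obtain ⟨w, hw⟩ := exists_det2_ne_zero hu
    have hn : det2 u w ≠ 0 := by rw [hw]; exact one_ne_zero
    exact ⟨Point.mk K w (ne_zero_of_det2_right hn), by rwa [form_mk, Ne, cls_eq_zero]⟩

/-- A map of `Ω` which preserves `s_g` and maps each `C`-orbit into a `C`-orbit permutes the
elements of `C` in the same way at all points. -/
theorem exists_semilinear {f : Point K → Point K} {g : Fˣ ⧸ K}
    (hs : ∀ α β, form K α β = g → form K (f α) (f β) = g)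
    (hr : ∀ (h : Fˣ ⧸ K) α, ∃ h' : Fˣ ⧸ K, f (h • α) = h' • f α) :
    ∃ φ : Fˣ ⧸ K → Fˣ ⧸ K, ∀ h α, f (h • α) = φ h • f α := by
  choose ψ hψ using hr
  -- The scalars `h` and `h⁻¹` cancel in the form, so the moved pair is still in `s_g`.
  have hadj : ∀ h α β, form K α β = g → ψ h α * ψ h⁻¹ β = 1 := by
    intro h α β hαβ
    have h1 : form K (h • α) (h⁻¹ • β) = g := by
      rw [form_smul_smul, mul_inv_cancel, hαβ]
      exact one_mul (M := WithZero (Fˣ ⧸ K)) _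
    have h2 := hs _ _ h1
    rw [hψ, hψ, form_smul_smul, hs _ _ hαβ, ← WithZero.coe_mul, WithZero.coe_inj] at h2
    exact (eq_mul_inv_of_mul_eq h2).trans (mul_inv_cancel g)
  -- Both values equal the inverse of `ψ h⁻¹ β` for a common neighbour `β`.
  have hdiff : ∀ h α γ, form K α γ ≠ 0 → ψ h α = ψ h γ := by
    intro h α γ hαγ
    obtain ⟨β, h1, h2⟩ := exists_common_neighbour hαγ g
    exact (eq_inv_of_mul_eq_one_left (hadj h α β h1)).trans
      (eq_inv_of_mul_eq_one_left (hadj h γ β h2)).symm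
  have hconst : ∀ h α γ, ψ h α = ψ h γ := by
    intro h α γ
    by_cases hαγ : form K α γ = 0
    · obtain ⟨t, rfl⟩ := exists_smul_of_form_eq_zero hαγ
      obtain ⟨δ, hδ⟩ := exists_form_ne_zero α
      -- The point `δ` lies outside the common orbit of `α` and `t • α`, so `hdiff` applies to both.
      rw [hdiff h α δ hδ]
      refine (hdiff h _ _ ?_).symm
      rw [← one_smul_point δ, form_smul_smul]
      exact mul_ne_zero WithZero.coe_ne_zero hδ
    · exact hdiff h α γ hαγ
  obtain ⟨v, hv⟩ := exists_point (F := F)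
  exact ⟨fun h => ψ h (Point.mk K v hv), fun h α => by rw [hψ, hconst h α]⟩

/-! ### From semilinearity to isomorphism. -/

theorem mem_relImage_iff {Ω : Type*} (f : Equiv.Perm Ω) (s : Set (Ω × Ω)) (α β : Ω) :
    (f α, f β) ∈ relImage f s ↔ (α, β) ∈ s :=
  (f.injective.prodMap f.injective).mem_set_image (a := (α, β))

theorem relImage_eq_iff {Ω : Type*} (f : Equiv.Perm Ω) (s t : Set (Ω × Ω)) :
    relImage f s = t ↔ ∀ α β, (α, β) ∈ s ↔ (f α, f β) ∈ t := by
  refine ⟨fun h α β => by rw [← h, mem_relImage_iff], fun h => ?_⟩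
  ext ⟨α, β⟩
  obtain ⟨α, rfl⟩ := f.surjective α
  obtain ⟨β, rfl⟩ := f.surjective β
  rw [mem_relImage_iff, h]

/-- A permutation of `Ω` which preserves `s_g` and maps each `C`-orbit into a `C`-orbit is an
isomorphism of the Tatra scheme. -/
theorem mem_iso_scheme [Finite F] (hK : (-1 : Fˣ) ∈ K) (f : Equiv.Perm (Point K)) {g : Fˣ ⧸ K}
    (hs : relImage f (relS K g) = relS K g)
    (hr : ∀ (h : Fˣ ⧸ K) α, ∃ h' : Fˣ ⧸ K, f (h • α) = h' • f α) :
    f ∈ (scheme K hK).iso := by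
  have hs' : ∀ α β, form K α β = g ↔ form K (f α) (f β) = g := (relImage_eq_iff f _ _).mp hs
  obtain ⟨φ, hφ⟩ := exists_semilinear (fun α β => (hs' α β).mp) hr
  obtain ⟨v, hv⟩ := exists_point (F := F)
  -- The action is free, so identities for `φ` can be tested at a single point.
  have hinj : Function.Injective φ := fun a b hab =>
    smul_point_cancel (f.injective (by rw [hφ, hφ, hab]) :
      a • Point.mk K v hv = b • Point.mk K v hv)
  have hsurj : Function.Surjective φ := Finite.surjective_of_injective hinj
  have hone : φ 1 = 1 := smul_point_cancel (α := f (Point.mk K v hv))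
    (by rw [← hφ, one_smul_point, one_smul_point])
  have hmul : ∀ a b, φ (a * b) = φ a * φ b := fun a b =>
    smul_point_cancel (α := f (Point.mk K v hv))
      (by rw [← hφ, mul_smul_point, hφ, hφ, mul_smul_point])
  have hinv : ∀ a, φ a⁻¹ = (φ a)⁻¹ := fun a =>
    eq_inv_of_mul_eq_one_left (by rw [← hmul, inv_mul_cancel, hone])
  have hR : ∀ a, relImage f (relR K a) = relR K (φ a) := fun a =>
    (relImage_eq_iff f _ _).mpr fun α β => by
      rw [mem_relR, mem_relR, ← hφ, f.injective.eq_iff]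
  -- The index is written `a * g` because only `s_g` is known to be fixed; as `a` varies these are
  -- all the relations `s_c`.
  have hS : ∀ a, relImage f (relS K (a * g)) = relS K (φ a * g) := fun a =>
    (relImage_eq_iff f _ _).mpr fun α β => by
      change form K α β = _ ↔ form K (f α) (f β) = _
      rw [← form_smul_right_eq_iff, ← form_smul_right_eq_iff, hs', hφ, hinv]
  have hRrange : relImage f '' Set.range (relR K) = Set.range (relR K) := by
    rw [← Set.range_comp, show relImage f ∘ relR K = relR K ∘ φ from funext hR,
      hsurj.range_comp]
  have hg : Function.Surjective fun a : Fˣ ⧸ K => a * g := mul_right_surjective g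
  have hSrange : relImage f '' Set.range (relS K) = Set.range (relS K) := by
    rw [← hg.range_comp (relS K), ← Set.range_comp,
      show relImage f ∘ relS K ∘ (fun a => a * g) = (relS K ∘ fun a => a * g) ∘ φ from funext hS,
      hsurj.range_comp]
  change relImage f '' (Set.range (relR K) ∪ Set.range (relS K)) = _
  rw [Set.image_union, hRrange, hSrange]
  rfl

end

end Tatra

/-! ### The fusion hypothesis gives preservation of `C`-orbits. -/

theorem proposition4p4 {F : Type*} [Field F] [Finite F]
    (p : ℕ) (hp : p.Prime) (hp4 : p % 4 = 3)
    (K : Subgroup Fˣ) (hK : K.index = p)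
    (M : Subgroup (MulAut (Fˣ ⧸ K))) (hM : M.index = 2)
    (C₁ C₂ : Set (Fˣ ⧸ K))
    (hC : {X | X ∈ Tatra.cycBasicSets M ∧ X ≠ {1}} = {C₁, C₂})
    (f : Equiv.Perm (Tatra.Point K)) (g : Fˣ ⧸ K)
    (hs : relImage f (Tatra.relS K g) = Tatra.relS K g)
    (hr : ({relImage f (Tatra.relRSet K C₁), relImage f (Tatra.relRSet K C₂)} :
        Set (Set (Tatra.Point K × Tatra.Point K))) =
      {Tatra.relRSet K C₁, Tatra.relRSet K C₂}) :
    f ∈ (Tatra.scheme K (Tatra.neg_one_mem hp4 hK)).iso := by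
  refine Tatra.mem_iso_scheme _ f hs fun h α => ?_
  -- The orbit `{1}` is neither `C₁` nor `C₂`, so the identity is treated separately.
  by_cases hh : h = 1
  · exact ⟨1, by rw [hh, Tatra.one_smul_point, Tatra.one_smul_point]⟩
  -- The orbit of `h` under `M` is `C₁` or `C₂`.
  have hX : ∃ X ∈ ({C₁, C₂} : Set (Set (Fˣ ⧸ K))), h ∈ X := by
    have hmem : h ∈ MulAction.orbit M h := MulAction.mem_orbit_self h
    refine ⟨MulAction.orbit M h, ?_, hmem⟩
    rw [← hC]
    exact ⟨⟨h, rfl⟩, fun he => hh (by rw [he] at hmem; exact hmem)⟩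
  obtain ⟨X, hXC, hhX⟩ := hX
  have hmem : (f α, f (h • α)) ∈ relImage f (Tatra.relRSet K X) :=
    (Tatra.mem_relImage_iff f _ _ _).mpr
      (Set.mem_biUnion hhX (Tatra.mem_relR.mpr rfl))
  have hY : relImage f (Tatra.relRSet K X) ∈
      ({Tatra.relRSet K C₁, Tatra.relRSet K C₂} : Set (Set (Tatra.Point K × Tatra.Point K))) := by
    rw [← hr]
    rcases hXC with rfl | rfl
    · exact Or.inl rfl
    · exact Or.inr rfl
  -- Whichever of the two relations is the image, it joins only points of one `C`-orbit; so a swap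
  -- of `r_{C₁}` and `r_{C₂}` does no harm.
  have hfib : ∀ Y : Set (Fˣ ⧸ K), (f α, f (h • α)) ∈ Tatra.relRSet K Y →
      ∃ h' : Fˣ ⧸ K, f (h • α) = h' • f α := by
    intro Y hm
    obtain ⟨h', -, hm⟩ := Set.mem_iUnion₂.mp hm
    exact ⟨h', Tatra.mem_relR.mp hm⟩
  rcases hY with hY | hY <;> exact hfib _ (hY ▸ hmem)
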